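/- **Theorem.** Let $H\colon \mathsf{Set}\to\mathsf{Set}$ be a finitary functor, i.e. for every set $A$ every element of $HA$ lies in the image of $Hm$ for the inclusion $m\colon A'\hookrightarrow A$ of some finite subset. *Notions.* A subcoalgebra (quotient) of a coalgebra is a homomorphism into (from) it carried by an injective (surjective) map; it is proper if it is not invertible. The same terms are used for pointed coalgebras $(A,a,x)$ ($a\colon A\to HA$, $x\in A$) with point-preserving homomorphisms. A pointed coalgebra is *well-pointed* if it has no proper quotient and no proper subobject. A coalgebra is *simple* if it has no proper quotient; the simple quotient of a coalgebra is the wide pushout of all its quotients. For a finite coalgebra $(A,a)$ and $x\in A$, the *well-pointed modification* $\mathrm{wp}(A,a,x)$ is the least subcoalgebra of the simple quotient of $(A,a)$ that contains the image of $x$, pointed by this image. A coalgebra is *locally finite* if every element lies in a finite subcoalgebra. An algebra $\alpha\colon HA\to A$ is *iterative* if for every finite set $X$ and every map $e\colon X\to HX+A$ there is a unique $e^\dagger\colon X\to A$ with $e^\dagger=[\alpha,A]\cdot(He^\dagger+A)\cdot e$. An *initial iterative algebra* is an initial object of the full subcategory of iterative algebras in the category of $H$-algebras. Let $\varrho H$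 be the set of all finite well-pointed coalgebras up to isomorphism of pointed coalgebras. For every finite coalgebra $(A,a)$ let $a^+\colon A\to\varrho H$ be given by $a^+(x)=\mathrm{wp}(A,a,x)$. Define $\psi^*\colon\varrho H\to H(\varrho H)$ by assigning to the element represented by $(A,a,x)$ the element $Ha^+(a(x))$. *Claims.* 1. $\psi^*$ does not depend on the choice of representatives. 2. $(\varrho H,\psi^*)$ is the final locally finite coalgebra: it is locally finite, and every locally finite coalgebra has a unique homomorphism into it. 3. The maps $a^+$ are coalgebra homomorphisms into $(\varrho H,\psi^*)$ and form a colimit cocone of the diagram of all finite coalgebras (the full subcategory of $\mathsf{Coalg}\,H$ on the finite coalgebras), in $\mathsf{Coalg}\,H$ and also, on underlying sets, in $\mathsf{Set}$. 4. $\psi^*$ is invertible, and $(\varrho H,(\psi^*)^{-1})$ is the initial iterative algebra for $H$: it is iterative, and it has a unique algebra homomorphism into every iterative algebra. In particular, every finitary set functor has an initial iterative algebra. -/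

import Mathlib

open CategoryTheory CategoryTheory.Limits CategoryTheory.Endofunctor

universe u

namespace SetCoalg

/-- A set functor is finitary if every element of `H A` lies in the image of `H m` for the
inclusion `m` of some finite subset of `A`. -/
def IsFinitary (H : Type u ⥤ Type u) : Prop :=
  ∀ (A : Type u) (x : H.obj A), ∃ S : Set A, S.Finite ∧
    x ∈ Set.range (H.map (↾(Subtype.val : S → A)))

/-- An algebra is iterative if every equation morphism `e : X ⟶ H X + A` with `X` finite has a
unique solution `s = [a, A] ∘ (H s + A) ∘ e`. -/
def IsIterative {H : Type u ⥤ Type u} (A : Endofunctor.Algebra H) : Prop :=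
  ∀ (X : Type u) [Finite X] (e : X → H.obj X ⊕ A.a),
    ∃! s : X → A.a, ∀ x, s x = Sum.elim A.str id (Sum.map (H.map (↾s)) id (e x))

/-- A coalgebra is locally finite if every element lies in a finite subcoalgebra. -/
def IsLocallyFinite {H : Type u ⥤ Type u} (A : Coalgebra H) : Prop :=
  ∀ x : A.V, ∃ (B : Coalgebra H) (m : B ⟶ A),
    Finite B.V ∧ Function.Injective m.f ∧ x ∈ Set.range m.f

/-- The finite coalgebras, as a property of objects of `Coalg H`. -/
def finiteCoalg (H : Type u ⥤ Type u) : ObjectProperty (Coalgebra H) := fun A => Finite A.V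

/-- A coalgebra is simple if it has no proper quotient. -/
def IsSimple {H : Type u ⥤ Type u} (A : Coalgebra H) : Prop :=
  ∀ (B : Coalgebra H) (e : A ⟶ B), Function.Surjective e.f → IsIso e

/-- Pointed coalgebras. -/
structure PointedCoalgebra (H : Type u ⥤ Type u) where
  coalg : Coalgebra H
  pt : coalg.V

/-- Morphisms of pointed coalgebras: point-preserving coalgebra homomorphisms. -/
@[ext]
structure PointedCoalgebra.Hom {H : Type u ⥤ Type u} (P Q : PointedCoalgebra H) where
  hom : P.coalg ⟶ Q.coalg
  map_pt : hom.f P.pt = Q.pt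

/-- The category of pointed coalgebras. -/
instance (H : Type u ⥤ Type u) : Category (PointedCoalgebra H) where
  Hom := PointedCoalgebra.Hom
  id P := ⟨𝟙 P.coalg, rfl⟩
  comp f g := ⟨f.hom ≫ g.hom, by
    have h1 := f.map_pt
    have h2 := g.map_pt
    simp [h1, h2]⟩

/-- A pointed coalgebra is well-pointed if it has no proper quotient and no proper subobject. -/
def IsWellPointed {H : Type u ⥤ Type u} (P : PointedCoalgebra H) : Prop :=
  (∀ (Q : PointedCoalgebra H) (e : P ⟶ Q), Function.Surjective e.hom.f → IsIso e) ∧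
  (∀ (Q : PointedCoalgebra H) (m : Q ⟶ P), Function.Injective m.hom.f → IsIso m)

/-- The category of finite well-pointed coalgebras. -/
abbrev FinWellPointed (H : Type u ⥤ Type u) :=
  ObjectProperty.FullSubcategory
    (fun P : PointedCoalgebra H => Finite P.coalg.V ∧ IsWellPointed P)

theorem isIso_of_bijective {H : Type u ⥤ Type u} {A B : Coalgebra H} (f : A ⟶ B)
    (hf : Function.Bijective f.f) : IsIso f := by
  have : IsIso f.f := (isIso_iff_bijective _).2 hf
  exact Coalgebra.iso_of_iso f

theorem bijective_of_isIso {H : Type u ⥤ Type u} {A B : Coalgebra H} (f : A ⟶ B)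
    [IsIso f] : Function.Bijective f.f :=
  (isIso_iff_bijective _).1 (inferInstanceAs (IsIso ((Coalgebra.forget H).map f)))

theorem isIso_of_bijective_pointed {H : Type u ⥤ Type u} {P Q : PointedCoalgebra H} (f : P ⟶ Q)
    (hf : Function.Bijective f.hom.f) : IsIso f := by
  have := isIso_of_bijective f.hom hf
  have h0 : (inv f.hom).f Q.pt = P.pt := by
    have h2 : (f.hom ≫ inv f.hom).f P.pt = P.pt := by rw [IsIso.hom_inv_id]; rfl
    rw [← f.map_pt]
    exact h2
  exact ⟨⟨inv f.hom, h0⟩, PointedCoalgebra.Hom.ext (IsIso.hom_inv_id f.hom),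
    PointedCoalgebra.Hom.ext (IsIso.inv_hom_id f.hom)⟩

theorem map_comp_apply {H : Type u ⥤ Type u} {X Y Z : Type u} (f : X → Y) (g : Y → Z)
    (z : H.obj X) : H.map (↾(g ∘ f)) z = H.map (↾g) (H.map (↾f) z) := by
  have : (↾(g ∘ f)) = (↾f) ≫ (↾g) := rfl
  rw [this, H.map_comp]; rfl

theorem hom_apply {H : Type u ⥤ Type u} {A B : Coalgebra H} (f : A ⟶ B) (x : A.V) :
    H.map f.f (A.str x) = B.str (f.f x) :=
  congrArg (fun k : A.V ⟶ H.obj B.V => k x) f.h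

/-- Homomorphisms from pointwise equations. -/
def mkHom {H : Type u ⥤ Type u} {A B : Coalgebra H} (f : A.V → B.V)
    (h : ∀ x, H.map (↾f) (A.str x) = B.str (f x)) : A ⟶ B where
  f := ↾f
  h := by ext x; exact h x

/-- Two elements are identified by some quotient of the coalgebra. -/
def quotRel {H : Type u ⥤ Type u} (A : Coalgebra H) (x y : A.V) : Prop :=
  ∃ (B : Coalgebra H) (e : A ⟶ B), Function.Surjective e.f ∧ e.f x = e.f y

/-- The simple quotient of a coalgebra, that is, the wide pushout of all its quotients: the
underlying set is the quotient by the equivalence relation generated by all the kernels. -/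
def simpleQuotient {H : Type u ⥤ Type u} (A : Coalgebra H) : Coalgebra H where
  V := Quot (quotRel A)
  str := ↾(Quot.lift (fun x => H.map (↾(Quot.mk (quotRel A))) (A.str x)) (by
    rintro x y ⟨B, e, he, hxy⟩
    obtain ⟨g, hg⟩ : ∃ g : B.V → Quot (quotRel A), Quot.mk (quotRel A) = g ∘ e.f := by
      refine ⟨fun b => Quot.mk _ (Function.surjInv he b), funext fun a => Quot.sound ?_⟩
      exact ⟨B, e, he, (Function.surjInv_eq he _).symm⟩
    have key : ∀ z : A.V, H.map (↾(Quot.mk (quotRel A))) (A.str z)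
        = H.map (↾g) (B.str (e.f z)) := by
      intro z
      rw [hg, map_comp_apply, ← hom_apply]; rfl
    simp only [key, hxy]))

/-- The canonical homomorphism onto the simple quotient. -/
def toSimpleQuotient {H : Type u ⥤ Type u} (A : Coalgebra H) : A ⟶ simpleQuotient A :=
  mkHom (Quot.mk (quotRel A)) (fun _ => rfl)

theorem isSimple_simpleQuotient {H : Type u ⥤ Type u} (A : Coalgebra H) :
    IsSimple (simpleQuotient A) := by
  intro B g hg
  refine isIso_of_bijective _ ⟨fun x y => ?_, hg⟩
  induction x using Quot.ind with | mk x => ?_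
  induction y using Quot.ind with | mk y => ?_
  intro h
  exact Quot.sound ⟨B, toSimpleQuotient A ≫ g, hg.comp Quot.mk_surjective, h⟩

theorem finite_simpleQuotient {H : Type u ⥤ Type u} (A : Coalgebra H) [Finite A.V] :
    Finite (simpleQuotient A).V :=
  inferInstanceAs (Finite (Quot (quotRel A)))

/-- A subset of a coalgebra that carries a subcoalgebra. -/
def IsSubcoalg {H : Type u ⥤ Type u} (A : Coalgebra H) (S : Set A.V) : Prop :=
  ∀ s ∈ S, A.str s ∈ Set.range (H.map (↾(Subtype.val : S → A.V)))

/-- The carrier of the least subcoalgebra containing `x`. -/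
def leastSub {H : Type u ⥤ Type u} (A : Coalgebra H) (x : A.V) : Set A.V :=
  ⋂₀ {S | x ∈ S ∧ IsSubcoalg A S}

theorem mem_leastSub {H : Type u ⥤ Type u} (A : Coalgebra H) (x : A.V) : x ∈ leastSub A x :=
  fun _ hS => hS.1

theorem range_map_mono {H : Type u ⥤ Type u} {X B : Type u} (f : X → B) (S : Set B)
    (hf : ∀ x, f x ∈ S) (z : H.obj X) :
    H.map (↾f) z ∈ Set.range (H.map (↾(Subtype.val : S → B))) :=
  ⟨H.map (↾(fun x => (⟨f x, hf x⟩ : S))) z, by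
    rw [← map_comp_apply]⟩

theorem IsSubcoalg.inter {H : Type u ⥤ Type u} {A : Coalgebra H} {S T : Set A.V} {x : A.V}
    (hS : IsSubcoalg A S) (hT : IsSubcoalg A T) (hxS : x ∈ S) (hxT : x ∈ T) :
    IsSubcoalg A (S ∩ T) := by
  classical
  rintro s ⟨hs, ht⟩
  obtain ⟨z, hz⟩ := hS s hs
  obtain ⟨w, hw⟩ := hT s ht
  let r : A.V → A.V := fun a => if a ∈ S then a else x
  have h1 : H.map (↾r) (A.str s) = A.str s := by
    rw [← hz, ← map_comp_apply]
    have h : r ∘ (Subtype.val : S → A.V) = Subtype.val := by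
      funext a
      simp [r]
    rw [h]
  rw [← h1, ← hw, ← map_comp_apply]
  refine range_map_mono _ _ (fun t => ?_) w
  by_cases h : t.1 ∈ S
  · simp [r, h]
  · simp [r, h, hxS, hxT]

theorem isSubcoalg_univ {H : Type u ⥤ Type u} (A : Coalgebra H) : IsSubcoalg A Set.univ := by
  intro s _
  have := range_map_mono (H := H) (id : A.V → A.V) Set.univ (fun _ => trivial) (A.str s)
  have h : H.map (↾(id : A.V → A.V)) (A.str s) = A.str s := by
    have h' : (↾(id : A.V → A.V)) = 𝟙 A.V := rfl
    rw [h', H.map_id]; rfl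
  rwa [h] at this

theorem isSubcoalg_leastSub {H : Type u ⥤ Type u} (A : Coalgebra H) [Finite A.V] (x : A.V) :
    IsSubcoalg A (leastSub A x) := by
  obtain ⟨S, hS⟩ := (Set.toFinite {S | x ∈ S ∧ IsSubcoalg A S}).exists_minimal
    ⟨Set.univ, trivial, isSubcoalg_univ A⟩
  have : leastSub A x = S := by
    refine Set.Subset.antisymm (Set.sInter_subset_of_mem hS.1) ?_
    intro s hs T hT
    exact (hS.2 (y := S ∩ T) ⟨⟨hS.1.1, hT.1⟩, hS.1.2.inter hT.2 hS.1.1 hT.1⟩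
      Set.inter_subset_left hs).2
  rw [this]
  exact hS.1.2

/-- The least subcoalgebra containing a given point. -/
noncomputable def reachablePart {H : Type u ⥤ Type u} (A : Coalgebra H) [Finite A.V] (x : A.V) :
    PointedCoalgebra H where
  coalg :=
    { V := leastSub A x
      str := ↾(fun s => (isSubcoalg_leastSub A x s.1 s.2).choose) }
  pt := ⟨x, mem_leastSub A x⟩

/-- The inclusion of the least subcoalgebra containing a given point. -/
noncomputable def reachableIncl {H : Type u ⥤ Type u} (A : Coalgebra H) [Finite A.V] (x : A.V) :
    (reachablePart A x).coalg ⟶ A :=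
  mkHom (Subtype.val : leastSub A x → A.V)
    (fun s => (isSubcoalg_leastSub A x s.1 s.2).choose_spec)

theorem isSubcoalg_range {H : Type u ⥤ Type u} {A B : Coalgebra H} (f : B ⟶ A) :
    IsSubcoalg A (Set.range f.f) := by
  rintro _ ⟨b, rfl⟩
  rw [← hom_apply]
  exact range_map_mono (f.f : B.V → A.V) _ (fun b => Set.mem_range_self b) _

/-- Subcoalgebras of simple coalgebras are simple. -/
theorem IsSimple.sub {H : Type u ⥤ Type u} {A B : Coalgebra H} (hA : IsSimple A) (m : B ⟶ A)
    (hm : Function.Injective m.f) : IsSimple B := by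
  intro C f hf
  refine isIso_of_bijective _ ⟨fun s t hst => hm ?_, hf⟩
  let r : A.V → A.V → Prop := fun a b => ∃ s t, f.f s = f.f t ∧ a = m.f s ∧ b = m.f t
  let k : C.V → Quot r := fun c => Quot.mk r (m.f (Function.surjInv hf c))
  have hk : (Quot.mk r ∘ m.f : B.V → Quot r) = k ∘ f.f := by
    funext b
    have hb : r (m.f b) (m.f (Function.surjInv hf (f.f b))) :=
      ⟨b, _, (Function.surjInv_eq hf _).symm, rfl, rfl⟩
    exact Quot.sound hb
  have key : ∀ b : B.V, H.map (↾(Quot.mk r)) (A.str (m.f b)) = H.map (↾k) (C.str (f.f b)) := by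
    intro b
    rw [← hom_apply, ← hom_apply]
    have h1 := map_comp_apply (H := H) (m.f : B.V → A.V) (Quot.mk r) (B.str b)
    have h2 := map_comp_apply (H := H) (f.f : B.V → C.V) k (B.str b)
    rw [hk] at h1
    exact h1.symm.trans h2
  let D : Coalgebra H :=
    { V := Quot r
      str := ↾(Quot.lift (fun x => H.map (↾(Quot.mk r)) (A.str x)) (by
        rintro _ _ ⟨s, t, h, rfl, rfl⟩
        simp only [key, h])) }
  let q : A ⟶ D := mkHom (B := D) (Quot.mk r) (fun _ => rfl)
  have := hA D q Quot.mk_surjective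
  exact (bijective_of_isIso q).1 (Quot.sound ⟨s, t, hst, rfl, rfl⟩)

theorem isWellPointed_reachablePart {H : Type u ⥤ Type u} (A : Coalgebra H) [Finite A.V]
    (x : A.V) (hA : IsSimple A) : IsWellPointed (reachablePart A x) := by
  constructor
  · intro Q e he
    have := hA.sub (reachableIncl A x) Subtype.val_injective Q.coalg e.hom he
    exact isIso_of_bijective_pointed e (bijective_of_isIso e.hom)
  · intro Q m hm
    refine isIso_of_bijective_pointed m ⟨hm, fun s => ?_⟩
    have hx : (m.hom ≫ reachableIncl A x).f Q.pt = x :=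
      congrArg (reachableIncl A x).f m.map_pt
    have hs : s.1 ∈ leastSub A x := s.2
    obtain ⟨b, hb⟩ := hs (Set.range (m.hom ≫ reachableIncl A x).f)
      ⟨⟨Q.pt, hx⟩, isSubcoalg_range _⟩
    exact ⟨b, Subtype.ext hb⟩

/-- The well-pointed modification of a finite pointed coalgebra `(A, a, x)`: form the simple
quotient, then the least subcoalgebra of it containing the image of `x`. -/
noncomputable def wp {H : Type u ⥤ Type u} (A : Coalgebra H) [Finite A.V] (x : A.V) :
    FinWellPointed H :=
  haveI := finite_simpleQuotient A
  ⟨reachablePart (simpleQuotient A) ((toSimpleQuotient A).f x),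
    inferInstanceAs (Finite (leastSub (simpleQuotient A) ((toSimpleQuotient A).f x))),
    isWellPointed_reachablePart _ _ (isSimple_simpleQuotient A)⟩

/-- Finite well-pointed coalgebras up to isomorphism. -/
abbrev IsoClasses (H : Type u ⥤ Type u) := Quotient (isIsomorphicSetoid (FinWellPointed H))

/-- There is only a set of finite well-pointed coalgebras up to isomorphism. -/
instance (H : Type u ⥤ Type u) : Small.{u} (IsoClasses H) := by
  let D := Σ n : ℕ, (ULift.{u} (Fin n) → H.obj (ULift.{u} (Fin n))) × ULift.{u} (Fin n)
  let toP : D → PointedCoalgebra H := fun d => ⟨⟨ULift.{u} (Fin d.1), ↾d.2.1⟩, d.2.2⟩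
  let W : ObjectProperty (PointedCoalgebra H) := fun P => Finite P.coalg.V ∧ IsWellPointed P
  let f : {d : D // W (toP d)} → IsoClasses H := fun d => Quotient.mk _ ⟨toP d.1, d.2⟩
  refine small_of_surjective (f := f) ?_
  intro t
  induction t using Quotient.inductionOn with | h P => ?_
  obtain ⟨P, hP, hW⟩ := P
  obtain ⟨n, ⟨φ⟩⟩ := Finite.exists_equiv_fin P.coalg.V
  let ψ : P.coalg.V ≃ ULift.{u} (Fin n) := φ.trans Equiv.ulift.symm
  let d : D := ⟨n, fun i => H.map (↾ψ) (P.coalg.str (ψ.symm i)), ψ P.pt⟩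
  let g : P ⟶ toP d := ⟨mkHom (B := (toP d).coalg) ψ (fun x => by
    change _ = H.map (↾ψ) (P.coalg.str (ψ.symm (ψ x)))
    rw [ψ.symm_apply_apply]), rfl⟩
  have hg : IsIso g := isIso_of_bijective_pointed g ψ.bijective
  have hd : W (toP d) := by
    refine ⟨inferInstanceAs (Finite (ULift.{u} (Fin n))), fun Q e he => ?_, fun Q m hm => ?_⟩
    · have := hW.1 Q (g ≫ e) (he.comp ψ.surjective)
      exact IsIso.of_isIso_comp_left g e
    · have hb : Function.Injective (m ≫ inv g).hom.f := by
        have h1 : Function.Injective (inv g ≫ g).hom.f := by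
          rw [IsIso.inv_hom_id]; exact Function.injective_id
        have h2 : Function.Injective (inv g).hom.f := Function.Injective.of_comp (f := g.hom.f) h1
        exact h2.comp hm
      have := hW.2 Q (m ≫ inv g) hb
      exact IsIso.of_isIso_comp_right m (inv g)
  refine ⟨⟨d, hd⟩, Quotient.sound ?_⟩
  exact ⟨(ObjectProperty.isoMk W (asIso g)).symm⟩

/-- `ϱH`: the set of all finite well-pointed coalgebras up to isomorphism. -/
abbrev Rho (H : Type u ⥤ Type u) : Type u := Shrink.{u} (IsoClasses H)

/-- The element of `ϱH` given by a finite well-pointed coalgebra. -/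
noncomputable def Rho.mk {H : Type u ⥤ Type u} (P : FinWellPointed H) : Rho H :=
  equivShrink _ (Quotient.mk _ P)

/-- A finite well-pointed coalgebra representing a given element of `ϱH`. -/
noncomputable def Rho.rep {H : Type u ⥤ Type u} (t : Rho H) : FinWellPointed H :=
  Quotient.out ((equivShrink _).symm t)

/-- The function `a⁺ : A → ϱH` of a finite coalgebra, assigning to every element `x` the
well-pointed modification of `(A, a, x)`. -/
noncomputable def plus {H : Type u ⥤ Type u} (A : Coalgebra H) [Finite A.V] (x : A.V) : Rho H :=
  Rho.mk (wp A x)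

/-- The canonical coalgebra on `ϱH`: the structure assigns to the element represented by
`(A, a, x)` the element `H(a⁺)(a(x))` of `H(ϱH)`. -/
noncomputable def rhoCoalg (H : Type u ⥤ Type u) : Coalgebra H where
  V := Rho H
  str := ↾(fun t =>
    haveI := t.rep.property.1
    H.map (↾(plus t.rep.obj.coalg)) (t.rep.obj.coalg.str t.rep.obj.pt))

/-- The algebra on `ϱH` with the inverse of the canonical coalgebra structure. -/
noncomputable def rhoAlg (H : Type u ⥤ Type u) [IsIso (rhoCoalg H).str] :
    Endofunctor.Algebra H where
  a := (rhoCoalg H).V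
  str := inv (rhoCoalg H).str

end SetCoalg

open SetCoalg

namespace SetCoalg

variable {H : Type u ⥤ Type u}

/-! The class `plus A x` is the behaviour of `x`. A homomorphism of finite coalgebras induces an
injection of simple quotients, hence preserves behaviour (`plus_hom`). Conversely, `x` is linked to
the point of its well-pointed modification by the zigzag from `A` to its simple quotient and back
along an inclusion. So elements have equal behaviour exactly when the diagram of finite coalgebras
forces them together: `ϱH` is its colimit on sets (`existsUnique_desc`), and the structure and the
cocone lift to coalgebras.

Finality follows by gluing the maps `a⁺` over finite subcoalgebras (`plus_eq_plus`, `hom_eq_plus`).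
Finitarity makes `H(ϱH)` locally finite, so Lambek's argument inverts the structure. A finite
equation with parameters in `ϱH` turns into a finite coalgebra whose homomorphisms to `ϱH` are the
solutions. Conversely, finite coalgebras are parameter-free equations; their solutions in an
iterative algebra form a cocone, which yields initiality. -/

/-! ### Injections and subcoalgebras -/

theorem map_id_apply {X : Type u} (z : H.obj X) : H.map (↾(id : X → X)) z = z := by
  have h : (↾(id : X → X)) = 𝟙 X := rfl
  rw [h, H.map_id]; rfl

/-- An injection with nonempty domain splits, and functors preserve split injections; the empty map
has to be excluded. -/
theorem map_injective {X Y : Type u} [Nonempty X] {f : X → Y} (hf : Function.Injective f) :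
    Function.Injective (H.map (↾f)) := by
  refine Function.LeftInverse.injective (g := H.map (↾(Function.invFun f))) fun z => ?_
  rw [← map_comp_apply, Function.invFun_comp hf, map_id_apply]

theorem map_hom_apply {A B : Coalgebra H} (f : A ⟶ B) (x : A.V) {Y : Type u} (g : B.V → Y) :
    H.map (↾g) (B.str (f.f x)) = H.map (↾(fun a => g (f.f a))) (A.str x) := by
  rw [← hom_apply]
  exact (map_comp_apply (f.f : A.V → B.V) g _).symm

/-- A homomorphism factorizes through an injective one as soon as its elements do. -/
theorem exists_lift {A B C : Coalgebra H} (m : B ⟶ A) (hm : Function.Injective m.f) (g : C ⟶ A)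
    (hg : ∀ c, ∃ b, m.f b = g.f c) : ∃ h : C ⟶ B, ∀ c, m.f (h.f c) = g.f c := by
  choose h hh using hg
  refine ⟨mkHom h fun c => ?_, hh⟩
  have : Nonempty B.V := ⟨h c⟩
  refine map_injective (H := H) (f := (m.f : B.V → A.V)) hm ?_
  rw [← map_comp_apply]
  have e : (m.f : B.V → A.V) ∘ h = g.f := funext hh
  rw [e]
  exact (hom_apply g c).trans ((congrArg A.str (hh c).symm).trans (hom_apply m (h c)).symm)

/-- The coalgebra carried by a subset closed under the structure. -/
noncomputable def subCoalg (A : Coalgebra H) (S : Set A.V) (hS : IsSubcoalg A S) :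
    Coalgebra H where
  V := S
  str := ↾(fun s => (hS s.1 s.2).choose)

/-- The inclusion of a subcoalgebra. -/
noncomputable def subIncl (A : Coalgebra H) (S : Set A.V) (hS : IsSubcoalg A S) :
    subCoalg A S hS ⟶ A :=
  mkHom (Subtype.val : S → A.V) (fun s => (hS s.1 s.2).choose_spec)

theorem exists_lift_subCoalg {A C : Coalgebra H} {S : Set A.V} (hS : IsSubcoalg A S) (g : C ⟶ A)
    (hg : ∀ c, g.f c ∈ S) :
    ∃ h : C ⟶ subCoalg A S hS, ∀ c, (subIncl A S hS).f (h.f c) = g.f c :=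
  exists_lift (subIncl A S hS) Subtype.val_injective g fun c => ⟨⟨g.f c, hg c⟩, rfl⟩

theorem IsSubcoalg.union {A : Coalgebra H} {S T : Set A.V}
    (hS : IsSubcoalg A S) (hT : IsSubcoalg A T) : IsSubcoalg A (S ∪ T) := by
  rintro s (hs | hs)
  · obtain ⟨z, hz⟩ := hS s hs
    rw [← hz]
    exact range_map_mono (Subtype.val : S → A.V) _ (fun t => Or.inl t.2) z
  · obtain ⟨z, hz⟩ := hT s hs
    rw [← hz]
    exact range_map_mono (Subtype.val : T → A.V) _ (fun t => Or.inr t.2) z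

/-! ### Simple quotients -/

/-- A homomorphism into a simple coalgebra identifies all elements identified by a quotient of
its domain. -/
theorem IsSimple.eq_of_quotient {A B C : Coalgebra H} (hA : IsSimple A) (m : B ⟶ A) (f : B ⟶ C)
    (hf : Function.Surjective f.f) {s t : B.V} (hst : f.f s = f.f t) : m.f s = m.f t := by
  -- `Quot r` is the pushout of `f` along `m`, with second leg `k`. It carries a quotient of `A`,
  -- which simplicity makes injective.
  let r : A.V → A.V → Prop := fun a b => ∃ s t, f.f s = f.f t ∧ a = m.f s ∧ b = m.f t
  let k : C.V → Quot r := fun c => Quot.mk r (m.f (Function.surjInv hf c))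
  have hk : (fun b => Quot.mk r (m.f b) : B.V → Quot r) = fun b => k (f.f b) := by
    funext b
    have hb : r (m.f b) (m.f (Function.surjInv hf (f.f b))) :=
      ⟨b, _, (Function.surjInv_eq hf _).symm, rfl, rfl⟩
    exact Quot.sound hb
  have key : ∀ b : B.V, H.map (↾(Quot.mk r)) (A.str (m.f b)) = H.map (↾k) (C.str (f.f b)) := by
    intro b
    rw [map_hom_apply, map_hom_apply, hk]
  let D : Coalgebra H :=
    { V := Quot r
      str := ↾(Quot.lift (fun x => H.map (↾(Quot.mk r)) (A.str x)) (by
        rintro _ _ ⟨s, t, h, rfl, rfl⟩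
        simp only [key, h])) }
  let q : A ⟶ D := mkHom (B := D) (Quot.mk r) (fun _ => rfl)
  have := hA D q Quot.mk_surjective
  exact (bijective_of_isIso q).1 (Quot.sound ⟨s, t, hst, rfl, rfl⟩)

/-- Corestricting `f` to its image gives a quotient with the same kernel. -/
theorem quotRel_of_eq {A B : Coalgebra H} (f : A ⟶ B) {x y : A.V} (h : f.f x = f.f y) :
    quotRel A x y := by
  obtain ⟨e, he⟩ := exists_lift_subCoalg (isSubcoalg_range f) f fun c => ⟨c, rfl⟩
  refine ⟨_, e, ?_, Subtype.val_injective ?_⟩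
  · rintro ⟨_, a, rfl⟩
    exact ⟨a, Subtype.val_injective (he a)⟩
  · exact (he x).trans (h.trans (he y).symm)

/-- Simple quotients are functorial, and the induced homomorphisms are injective. -/
theorem exists_simpleQuotient_map {A B : Coalgebra H} (f : A ⟶ B) :
    ∃ k : simpleQuotient A ⟶ simpleQuotient B, Function.Injective k.f ∧
      ∀ x, k.f ((toSimpleQuotient A).f x) = (toSimpleQuotient B).f (f.f x) := by
  -- The kernel of `g` is exactly `quotRel A`, so the induced map is both well defined and
  -- injective.
  let g := f ≫ toSimpleQuotient B
  have hg : ∀ x y, quotRel A x y → g.f x = g.f y := by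
    rintro x y ⟨C, e, he, hxy⟩
    exact (isSimple_simpleQuotient B).eq_of_quotient g e he hxy
  let k : (simpleQuotient A).V → (simpleQuotient B).V := Quot.lift g.f hg
  refine ⟨mkHom k ?_, ?_, fun x => rfl⟩
  · intro x
    induction x using Quot.ind with | mk x => ?_
    exact (map_hom_apply (toSimpleQuotient A) x k).trans (hom_apply g x)
  · intro x y
    induction x using Quot.ind with | mk x => ?_
    induction y using Quot.ind with | mk y => ?_
    exact fun h => Quot.sound (quotRel_of_eq g h)

/-! ### Behaviour of elements of finite coalgebras -/

theorem Rho.mk_eq_mk {P Q : FinWellPointed H} (f : P.obj ⟶ Q.obj) [IsIso f] :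
    Rho.mk P = Rho.mk Q :=
  congrArg (equivShrink _) (Quotient.sound ⟨ObjectProperty.isoMk _ (asIso f)⟩)

theorem nonempty_hom_of_mk_eq {P Q : FinWellPointed H} (h : Rho.mk P = Rho.mk Q) :
    Nonempty (P.obj ⟶ Q.obj) := by
  obtain ⟨i⟩ := Quotient.exact ((equivShrink _).injective h)
  exact ⟨i.hom.hom⟩

theorem Rho.mk_rep (t : Rho H) : Rho.mk t.rep = t := by
  simp [Rho.mk, Rho.rep]

theorem mem_of_mem_leastSub {A B : Coalgebra H} [Finite A.V] {x : A.V}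
    (s : (reachablePart A x).coalg.V) {f : B ⟶ A} (hx : x ∈ Set.range f.f) :
    (reachableIncl A x).f s ∈ Set.range f.f :=
  Subtype.property (p := (· ∈ leastSub A x)) s _ ⟨hx, isSubcoalg_range f⟩

/-- The maps `a⁺` are compatible with homomorphisms of finite coalgebras. -/
theorem plus_hom {A B : Coalgebra H} [Finite A.V] [Finite B.V] (f : A ⟶ B) (x : A.V) :
    plus B (f.f x) = plus A x := by
  obtain ⟨k, hk, hkx⟩ := exists_simpleQuotient_map f
  have := finite_simpleQuotient A
  have := finite_simpleQuotient B
  let i := reachableIncl (simpleQuotient A) ((toSimpleQuotient A).f x)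
  let j := reachableIncl (simpleQuotient B) ((toSimpleQuotient B).f (f.f x))
  have hi : Function.Injective (i ≫ k).f := hk.comp Subtype.val_injective
  -- The image of `i ≫ k` is a subcoalgebra containing the point, so the least one, `j`, factors
  -- through it. The factor is a subobject of a well-pointed coalgebra, hence invertible.
  obtain ⟨h, hh⟩ := exists_lift (i ≫ k) hi j fun c =>
    mem_of_mem_leastSub c (f := i ≫ k) ⟨(wp A x).obj.pt, hkx x⟩
  let p : (wp B (f.f x)).obj ⟶ (wp A x).obj := ⟨h, hi ((hh _).trans (hkx x).symm)⟩
  have hp : Function.Injective p.hom.f := fun a b hab =>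
    Subtype.val_injective (((hh a).symm.trans (congrArg (i ≫ k).f hab)).trans (hh b))
  have := (wp A x).property.2.2 _ p hp
  exact Rho.mk_eq_mk p

/-- A well-pointed coalgebra equals its simple quotient, and the least subcoalgebra at its point is
not proper. -/
theorem plus_pt (P : FinWellPointed H) [Finite P.obj.coalg.V] :
    plus P.obj.coalg P.obj.pt = Rho.mk P := by
  have := finite_simpleQuotient P.obj.coalg
  let S : PointedCoalgebra H := ⟨_, (toSimpleQuotient P.obj.coalg).f P.obj.pt⟩
  let q : P.obj ⟶ S := ⟨toSimpleQuotient P.obj.coalg, rfl⟩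
  have : IsIso q := P.property.2.1 _ q Quot.mk_surjective
  let i : (wp P.obj.coalg P.obj.pt).obj ⟶ S := ⟨reachableIncl S.coalg S.pt, rfl⟩
  have h1 : Function.Injective (inv q).hom.f := by
    refine Function.Injective.of_comp (f := q.hom.f) ?_
    change Function.Injective (inv q ≫ q).hom.f
    rw [IsIso.inv_hom_id]; exact Function.injective_id
  have := P.property.2.2 _ (i ≫ inv q) (h1.comp Subtype.val_injective)
  exact Rho.mk_eq_mk (i ≫ inv q)

instance finite_rep (t : Rho H) : Finite t.rep.obj.coalg.V := t.rep.property.1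

theorem plus_rep (t : Rho H) : plus t.rep.obj.coalg t.rep.obj.pt = t :=
  (plus_pt _).trans t.mk_rep

/-- Elements of finite coalgebras are identified by `a⁺` whenever some homomorphisms into a
common coalgebra identify them. -/
theorem plus_eq_plus {A B C : Coalgebra H} [Finite A.V] [Finite B.V] (f : A ⟶ C) (g : B ⟶ C)
    {x : A.V} {y : B.V} (h : f.f x = g.f y) : plus A x = plus B y := by
  -- `C` may be infinite; the union of the two images is a finite subcoalgebra receiving both.
  have hS := (isSubcoalg_range f).union (isSubcoalg_range g)
  obtain ⟨f', hf⟩ := exists_lift_subCoalg hS f fun c => Or.inl ⟨c, rfl⟩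
  obtain ⟨g', hg⟩ := exists_lift_subCoalg hS g fun c => Or.inr ⟨c, rfl⟩
  have : Finite (subCoalg C _ hS).V :=
    ((Set.finite_range f.f).union (Set.finite_range g.f)).to_subtype
  rw [← plus_hom f', ← plus_hom g']
  exact congrArg _ (Subtype.val_injective ((hf x).trans (h.trans (hg y).symm)))

/-- Values of a compatible family on finite coalgebras depend only on `a⁺`. -/
theorem eq_of_plus_eq {Y : Type u} (s : ∀ A : Coalgebra H, Finite A.V → A.V → Y)
    (hs : ∀ (A B : Coalgebra H) (hA : Finite A.V) (hB : Finite B.V) (f : A ⟶ B) (x : A.V),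
      s B hB (f.f x) = s A hA x)
    {A B : Coalgebra H} (hA : Finite A.V) (hB : Finite B.V) {x : A.V} {y : B.V}
    (h : plus A x = plus B y) : s A hA x = s B hB y := by
  -- Compatibility along the zigzag through the simple quotient moves the value to the modification.
  have key : ∀ (A : Coalgebra H) (hA : Finite A.V) (x : A.V),
      s (wp A x).obj.coalg (wp A x).property.1 (wp A x).obj.pt = s A hA x := fun A hA x => by
    have := finite_simpleQuotient A
    exact (hs _ _ (wp A x).property.1 (finite_simpleQuotient A) (reachableIncl _ _) _).symm.trans
      (hs _ _ hA (finite_simpleQuotient A) (toSimpleQuotient A) x)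
  obtain ⟨p⟩ := nonempty_hom_of_mk_eq h
  rw [← key A, ← key B, ← hs _ _ (wp A x).property.1 (wp B y).property.1 p.hom, p.map_pt]

/-- The universal property of `ϱH` on the level of sets. -/
theorem existsUnique_desc {Y : Type u} (s : ∀ A : Coalgebra H, Finite A.V → A.V → Y)
    (hs : ∀ (A B : Coalgebra H) (hA : Finite A.V) (hB : Finite B.V) (f : A ⟶ B) (x : A.V),
      s B hB (f.f x) = s A hA x) :
    ∃! h : Rho H → Y, ∀ (A : Coalgebra H) (hA : Finite A.V) (x : A.V),
      h (plus A x) = s A hA x := by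
  refine ⟨fun t => s t.rep.obj.coalg t.rep.property.1 t.rep.obj.pt, fun A hA x => ?_,
    fun h hh => funext fun t => ?_⟩
  · exact eq_of_plus_eq s hs _ _ (plus_rep _)
  · exact (congrArg h (plus_rep t).symm).trans (hh _ _ _)

/-! ### The coalgebra `ϱH` and its finality -/

theorem map_plus_str {A B : Coalgebra H} [Finite A.V] [Finite B.V] (f : A ⟶ B) (x : A.V) :
    H.map (↾(plus B)) (B.str (f.f x)) = H.map (↾(plus A)) (A.str x) := by
  rw [map_hom_apply, funext (plus_hom f)]

theorem rhoCoalg_str_mk (P : FinWellPointed H) [Finite P.obj.coalg.V] :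
    (rhoCoalg H).str (Rho.mk P) =
      H.map (↾(plus P.obj.coalg)) (P.obj.coalg.str P.obj.pt) := by
  obtain ⟨p⟩ := nonempty_hom_of_mk_eq (Rho.mk_rep (Rho.mk P)).symm
  have h := map_plus_str p.hom P.obj.pt
  rw [p.map_pt] at h
  exact h

/-- The homomorphism `a⁺`. -/
noncomputable def plusHom (A : Coalgebra H) [Finite A.V] : A ⟶ rhoCoalg H :=
  mkHom (B := rhoCoalg H) (plus A) fun x => by
    have := (wp A x).property.1
    have := finite_simpleQuotient A
    let i : (wp A x).obj.coalg ⟶ simpleQuotient A := reachableIncl _ _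
    exact (map_plus_str (toSimpleQuotient A) x).symm.trans
      ((map_plus_str i (wp A x).obj.pt).trans (rhoCoalg_str_mk (wp A x)).symm)

/-- Elements in the image of a finite coalgebra lie in a finite subcoalgebra. -/
theorem isLocallyFinite_of_forall_exists {A : Coalgebra H}
    (h : ∀ x : A.V, ∃ (B : Coalgebra H) (f : B ⟶ A), Finite B.V ∧ x ∈ Set.range f.f) :
    IsLocallyFinite A := by
  intro x
  obtain ⟨B, f, hB, hx⟩ := h x
  exact ⟨_, subIncl A _ (isSubcoalg_range f), (Set.finite_range f.f).to_subtype,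
    Subtype.val_injective, ⟨x, hx⟩, rfl⟩

theorem isLocallyFinite_rhoCoalg : IsLocallyFinite (rhoCoalg H) :=
  isLocallyFinite_of_forall_exists fun (t : Rho H) =>
    ⟨_, plusHom t.rep.obj.coalg, inferInstance, _, plus_rep t⟩

/-- The value `f.f x` is also hit by `plusHom` from its own representative, so `plus_eq_plus`
applies. This gives uniqueness in finality and of solutions. -/
theorem hom_eq_plus {A : Coalgebra H} [Finite A.V] (f : A ⟶ rhoCoalg H) (x : A.V) :
    f.f x = plus A x := by
  obtain ⟨t, ht⟩ : ∃ t : Rho H, f.f x = t := ⟨_, rfl⟩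
  rw [ht, ← plus_rep t]
  exact plus_eq_plus (plusHom _) f ((plus_rep t).trans ht.symm)

theorem nonempty_unique_hom {B : Coalgebra H} (hB : IsLocallyFinite B) :
    Nonempty (Unique (B ⟶ rhoCoalg H)) := by
  choose C m hC _ c hc using hB
  let f : B.V → Rho H := fun x => plus (C x) (c x)
  -- On each chosen finite subcoalgebra `f` agrees with `a⁺`, so being a homomorphism can be checked
  -- there.
  have hf : ∀ x y, f ((m x).f y) = plus (C x) y := fun x y =>
    plus_eq_plus (m _) (m x) (hc _)
  refine ⟨⟨⟨mkHom (B := rhoCoalg H) f fun x => ?_⟩, fun g => ?_⟩⟩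
  · have h := map_hom_apply (m x) (c x) f
    rw [hc, funext (hf x)] at h
    exact h.trans (hom_apply (plusHom (C x)) (c x))
  · refine Coalgebra.Hom.ext ?_
    ext x
    have h := hom_eq_plus (m x ≫ g) (c x)
    exact (congrArg g.f (hc x).symm).trans h

theorem rhoCoalg_str_plus (A : Coalgebra H) [Finite A.V] (x : A.V) :
    (rhoCoalg H).str (plus A x) = H.map (↾(plus A)) (A.str x) :=
  (hom_apply (plusHom A) x).symm

/-! ### The colimit of all finite coalgebras -/

/-- The compatible cocone formed by the maps `a⁺`. -/
noncomputable def plusNatTrans (H : Type u ⥤ Type u) :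
    (finiteCoalg H).ι ⟶ (Functor.const (finiteCoalg H).FullSubcategory).obj (rhoCoalg H) where
  app A :=
    have : Finite A.obj.V := A.property
    plusHom A.obj
  naturality A B f := by
    have : Finite A.obj.V := A.property
    have : Finite B.obj.V := B.property
    refine Coalgebra.Hom.ext ?_
    ext x
    exact plus_hom f.hom x

theorem existsUnique_desc_of_natTrans {Y : Type u}
    (s : (finiteCoalg H).ι ⋙ Coalgebra.forget H ⟶
      (Functor.const (finiteCoalg H).FullSubcategory).obj Y) :
    ∃! h : Rho H → Y, ∀ (A : Coalgebra H) (hA : Finite A.V) (x : A.V),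
      h (plus A x) = s.app ⟨A, hA⟩ x :=
  existsUnique_desc (fun A hA x => s.app ⟨A, hA⟩ x) fun A B hA hB f x =>
    congrArg (fun k : A.V ⟶ Y => k x)
      (s.naturality (X := ⟨A, hA⟩) (Y := ⟨B, hB⟩) (ObjectProperty.homMk f))

theorem nonempty_isColimit_forget :
    Nonempty (IsColimit ((Coalgebra.forget H).mapCocone
      (Cocone.mk (rhoCoalg H) (plusNatTrans H)))) := by
  choose d hd hu using fun s : Cocone ((finiteCoalg H).ι ⋙ Coalgebra.forget H) =>
    existsUnique_desc_of_natTrans s.ι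
  refine ⟨⟨fun s => ↾(d s), fun s A => ?_, fun s m hm => ?_⟩⟩
  · ext x
    exact hd s A.obj A.property x
  · ext x
    refine congrFun (hu s m fun A hA x => ?_) x
    exact congrArg (fun k : A.V ⟶ s.pt => k x) (hm ⟨A, hA⟩)

/-- The factorization on sets is a homomorphism because it is one after composing with the jointly
surjective maps `a⁺`. -/
theorem nonempty_isColimit :
    Nonempty (IsColimit (Cocone.mk (rhoCoalg H) (plusNatTrans H))) := by
  choose d hd hu using fun s : Cocone (finiteCoalg H).ι =>
    existsUnique_desc_of_natTrans ((Coalgebra.forget H).mapCocone s).ι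
  refine ⟨⟨fun s => mkHom (A := rhoCoalg H) (d s) fun (t : Rho H) => ?_, fun s A => ?_,
    fun s m hm => ?_⟩⟩
  · have hA : Finite t.rep.obj.coalg.V := inferInstance
    rw [← plus_rep t, hd, rhoCoalg_str_plus]
    refine (map_comp_apply _ _ _).symm.trans (Eq.trans ?_ (hom_apply (s.ι.app ⟨_, hA⟩) _))
    exact congrArg (fun k : t.rep.obj.coalg.V → s.pt.V => H.map (↾k) _) (funext (hd s _ hA))
  · refine Coalgebra.Hom.ext ?_
    ext x
    exact hd s A.obj A.property x
  · refine Coalgebra.Hom.ext ?_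
    ext x
    refine congrFun (hu s m.f fun A hA x => ?_) x
    exact congrArg (fun k : A ⟶ s.pt => k.f x) (hm ⟨A, hA⟩)

/-! ### Invertibility of the structure -/

/-- Every finite family of elements of `ϱH` comes from a single finite coalgebra. -/
theorem exists_finite_plus_eq {I : Type u} [Finite I] (r : I → Rho H) :
    ∃ (T : Coalgebra H) (_ : Finite T.V) (c : I → T.V), ∀ i, plus T (c i) = r i := by
  let P : I → Coalgebra H := fun i => (r i).rep.obj.coalg
  -- The coproduct of the representatives.
  let T : Coalgebra H :=
    { V := Σ i, (P i).V
      str := ↾(fun p => H.map (↾(Sigma.mk p.1)) ((P p.1).str p.2)) }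
  have hP : ∀ i, Finite (P i).V := fun i => (r i).rep.property.1
  have hT : Finite T.V := inferInstanceAs (Finite (Σ i, (P i).V))
  refine ⟨T, hT, fun i => ⟨i, (r i).rep.obj.pt⟩, fun i => ?_⟩
  let f : P i ⟶ T := mkHom (B := T) (fun p => Sigma.mk i p) fun _ => rfl
  exact (plus_hom f _).trans (plus_rep _)

/-- The coalgebra `H(ϱH)`. -/
noncomputable def mapRhoCoalg (H : Type u ⥤ Type u) : Coalgebra H where
  V := H.obj (Rho H)
  str := H.map (rhoCoalg H).str

theorem isLocallyFinite_mapRhoCoalg (hH : IsFinitary H) : IsLocallyFinite (mapRhoCoalg H) := by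
  refine isLocallyFinite_of_forall_exists fun (z : H.obj (Rho H)) => ?_
  obtain ⟨S, hS, v, hv⟩ := hH _ z
  have : Finite S := hS
  obtain ⟨T, hT, c, hc⟩ := exists_finite_plus_eq (Subtype.val : S → Rho H)
  obtain ⟨w, hw⟩ : ∃ w, H.map (↾(plus T)) w = z := by
    refine ⟨H.map (↾c) v, ?_⟩
    rw [← map_comp_apply, ← hv]
    exact congrArg (fun k : S → Rho H => H.map (↾k) v) (funext hc)
  -- A new point with structure `w` is adjoined to `T`; the homomorphism `f` below sends it to `z`.
  let g : T.V ⊕ PUnit.{u + 1} → H.obj T.V := Sum.elim T.str fun _ => w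
  let E : Coalgebra H :=
    { V := T.V ⊕ PUnit.{u + 1}
      str := ↾(fun x => H.map (↾Sum.inl) (g x)) }
  let f : E ⟶ mapRhoCoalg H := mkHom (A := E) (B := mapRhoCoalg H)
    (fun x => H.map (↾(plus T)) (g x)) fun x => by
      refine (map_comp_apply _ _ _).symm.trans ?_
      refine Eq.trans ?_ (map_comp_apply (plus T) (rhoCoalg H).str (g x))
      exact congrArg (fun k : T.V → H.obj (Rho H) => H.map (↾k) (g x))
        (funext fun y => (rhoCoalg_str_plus T y).symm)
  exact ⟨E, f, inferInstanceAs (Finite (T.V ⊕ PUnit.{u + 1})), Sum.inr ⟨⟩, hw⟩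

/-- The structure of `ϱH` is invertible. -/
theorem isIso_rhoCoalg_str (hH : IsFinitary H) : IsIso (rhoCoalg H).str := by
  obtain ⟨u⟩ := nonempty_unique_hom (isLocallyFinite_mapRhoCoalg hH)
  obtain ⟨v⟩ := nonempty_unique_hom (isLocallyFinite_rhoCoalg (H := H))
  -- Lambek's argument: `a ≫ b` is the identity by finality, and the homomorphism square of `b`
  -- turns this into the other identity.
  let a : rhoCoalg H ⟶ mapRhoCoalg H := ⟨(rhoCoalg H).str, rfl⟩
  let b : mapRhoCoalg H ⟶ rhoCoalg H := u.default
  have h : a ≫ b = 𝟙 _ := Subsingleton.elim _ _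
  have h1 : (rhoCoalg H).str ≫ b.f = 𝟙 _ := congrArg Coalgebra.Hom.f h
  refine ⟨b.f, h1, ?_⟩
  have h2 : H.map (rhoCoalg H).str ≫ H.map b.f = 𝟙 _ :=
    (H.map_comp _ _).symm.trans ((congrArg H.map h1).trans (H.map_id _))
  exact b.h.symm.trans h2

/-! ### The initial iterative algebra -/

theorem rhoAlg_str_eq_iff [IsIso (rhoCoalg H).str] (z : H.obj (Rho H)) (t : Rho H) :
    (rhoAlg H).str z = t ↔ z = (rhoCoalg H).str t := by
  have h1 : ∀ t, (rhoAlg H).str ((rhoCoalg H).str t) = t := fun t =>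
    congrArg (fun k : (rhoCoalg H).V ⟶ (rhoCoalg H).V => k t) (IsIso.hom_inv_id (rhoCoalg H).str)
  have h2 : ∀ z, (rhoCoalg H).str ((rhoAlg H).str z) = z := fun z =>
    congrArg (fun k : H.obj (rhoCoalg H).V ⟶ H.obj (rhoCoalg H).V => k z)
      (IsIso.inv_hom_id (rhoCoalg H).str)
  exact ⟨fun h => h ▸ (h2 z).symm, fun h => h ▸ h1 t⟩

theorem isIterative_rhoAlg [IsIso (rhoCoalg H).str] : IsIterative (rhoAlg H) := by
  intro X _ (e : X → H.obj X ⊕ Rho H)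
  -- The finitely many parameters in `e` are realized as behaviours in one finite coalgebra `T`.
  obtain ⟨T, hT, e', he⟩ : ∃ (T : Coalgebra H) (_ : Finite T.V) (e' : X → H.obj X ⊕ T.V),
      ∀ x, Sum.map id (plus T) (e' x) = e x := by
    obtain ⟨T, hT, c, hc⟩ := exists_finite_plus_eq
      (fun x : {x // ∃ r, e x = Sum.inr r} => x.2.choose)
    refine ⟨T, hT, ?_⟩
    suffices ∀ x, ∃ y : H.obj X ⊕ T.V, Sum.map id (plus T) y = e x from
      ⟨fun x => (this x).choose, fun x => (this x).choose_spec⟩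
    intro x
    rcases hx : e x with z | r
    · exact ⟨Sum.inl z, rfl⟩
    · have h : ∃ r, e x = Sum.inr r := ⟨r, hx⟩
      refine ⟨Sum.inr (c ⟨x, h⟩), ?_⟩
      rw [← hx]
      exact (congrArg Sum.inr (hc ⟨x, h⟩)).trans h.choose_spec.symm
  -- A variable equated with a parameter `t` takes over the structure of `t`.
  let E : Coalgebra H :=
    { V := X ⊕ T.V
      str := ↾(Sum.elim
        (fun x => Sum.elim (H.map (↾Sum.inl)) (fun t => H.map (↾Sum.inr) (T.str t)) (e' x))
        (fun t => H.map (↾Sum.inr) (T.str t))) }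
  have hE : Finite E.V := inferInstanceAs (Finite (X ⊕ T.V))
  let j : T ⟶ E := mkHom (B := E) Sum.inr fun _ => rfl
  have hj : ∀ t, plus E (Sum.inr t) = plus T t := plus_hom j
  have hjs : ∀ w, H.map (↾(plus E)) (H.map (↾Sum.inr) w) = H.map (↾(plus T)) w := fun w => by
    rw [← map_comp_apply]
    exact congrArg (fun k : T.V → Rho H => H.map (↾k) w) (funext hj)
  refine ⟨fun x => plus E (Sum.inl x), fun x => ?_, fun s hs => funext fun x => ?_⟩
  · have h : (rhoCoalg H).str (plus E (Sum.inl x)) = H.map (↾(plus E))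
        (Sum.elim (H.map (↾Sum.inl)) (fun t => H.map (↾Sum.inr) (T.str t)) (e' x)) :=
      rhoCoalg_str_plus E (Sum.inl x)
    rw [← he x]
    rcases hx : e' x with z | t <;> rw [hx] at h
    · refine ((rhoAlg_str_eq_iff _ _).2 ?_).symm
      refine Eq.trans ?_ h.symm
      exact map_comp_apply (Sum.inl : X → X ⊕ T.V) (plus E) z
    · have h' := (h.trans (hjs _)).trans (rhoCoalg_str_plus T t).symm
      exact ((rhoAlg_str_eq_iff _ _).2 rfl).symm.trans ((rhoAlg_str_eq_iff _ _).2 h')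
  · let f : E ⟶ rhoCoalg H := mkHom (A := E) (B := rhoCoalg H) (Sum.elim s (plus T)) fun y => by
      have hr : ∀ w, H.map (↾(Sum.elim s (plus T))) (H.map (↾Sum.inr) w)
          = H.map (↾(plus T)) w := fun w => (map_comp_apply _ _ _).symm
      rcases y with x | t
      · have hx := hs x
        rw [← he x] at hx
        change H.map (↾(Sum.elim s (plus T))) (Sum.elim (H.map (↾Sum.inl))
          (fun t => H.map (↾Sum.inr) (T.str t)) (e' x)) = (rhoCoalg H).str (s x)
        rcases hx' : e' x with z | t <;> rw [hx'] at hx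
        · exact (map_comp_apply _ _ _).symm.trans ((rhoAlg_str_eq_iff _ _).1 hx.symm)
        · refine (hr _).trans ((rhoCoalg_str_plus T t).symm.trans ?_)
          exact congrArg (rhoCoalg H).str hx.symm
      · exact (hr _).trans (rhoCoalg_str_plus T t).symm
    exact hom_eq_plus f (Sum.inl x)

/-- Solutions of finite coalgebras, as equation morphisms, in an iterative algebra. -/
theorem existsUnique_solution {B : Endofunctor.Algebra H} (hB : IsIterative B) (A : Coalgebra H)
    (hA : Finite A.V) : ∃! s : A.V → B.a, ∀ x, s x = B.str (H.map (↾s) (A.str x)) :=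
  hB A.V fun x => Sum.inl (A.str x)

theorem nonempty_unique_rhoAlg_hom [IsIso (rhoCoalg H).str] {B : Endofunctor.Algebra H}
    (hB : IsIterative B) : Nonempty (Unique (rhoAlg H ⟶ B)) := by
  choose s hs hu using existsUnique_solution hB
  -- A solution of `A'` precomposed with `f` solves `A`, so unique solutions form a cocone.
  obtain ⟨h, hh, hhu⟩ := existsUnique_desc s fun A A' hA hA' f x => by
    refine congrFun (hu A hA (fun x => s A' hA' (f.f x)) fun x => ?_) x
    rw [← map_hom_apply]
    exact hs A' hA' (f.f x)
  have key : ∀ t : Rho H, B.str (H.map (↾h) ((rhoCoalg H).str t)) = h t := fun t => by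
    have hA : Finite t.rep.obj.coalg.V := inferInstance
    rw [← plus_rep t, rhoCoalg_str_plus, ← map_comp_apply, hh, hs]
    exact congrArg (fun k : t.rep.obj.coalg.V → B.a => B.str (H.map (↾k) _)) (funext (hh _ hA))
  refine ⟨⟨⟨⟨↾h, ?_⟩⟩, fun g => ?_⟩⟩
  · ext z
    have hz := (rhoAlg_str_eq_iff z _).1 rfl
    refine Eq.trans ?_ (key ((rhoAlg H).str z))
    exact congrArg (fun z => B.str (H.map (↾h) z)) hz
  · refine Endofunctor.Algebra.Hom.ext ?_
    ext t
    -- An algebra homomorphism composed with `a⁺` is a solution of `A`.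
    refine congrFun (hhu g.f fun A hA x => congrFun (hu A hA (fun x => g.f (plus A x)) ?_) x) t
    intro x
    have h1 : B.str (H.map g.f ((rhoCoalg H).str (plus A x))) =
        g.f ((rhoAlg H).str ((rhoCoalg H).str (plus A x))) :=
      congrArg (fun k : H.obj (rhoAlg H).a ⟶ B.a => k ((rhoCoalg H).str (plus A x))) g.h
    rw [(rhoAlg_str_eq_iff _ _).2 rfl, rhoCoalg_str_plus] at h1
    refine h1.symm.trans (congrArg B.str ?_)
    exact (map_comp_apply _ _ _).symm

end SetCoalg

theorem mainTheorem5 (H : Type u ⥤ Type u) (hH : IsFinitary H) :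
    -- the structure of `ϱH` does not depend on the choice of representatives
    (∀ (P : FinWellPointed H) (_ : Finite P.obj.coalg.V), (rhoCoalg H).str (Rho.mk P) =
      H.map (↾(plus P.obj.coalg)) (P.obj.coalg.str P.obj.pt)) ∧
    -- `ϱH` is the final locally finite coalgebra
    (IsLocallyFinite (rhoCoalg H) ∧
      ∀ B : Coalgebra H, IsLocallyFinite B → Nonempty (Unique (B ⟶ rhoCoalg H))) ∧
    -- the maps `a⁺` form a colimit cocone of the diagram of all finite coalgebras,
    -- in `Coalg H` and also on underlying sets
    (∃ c : (finiteCoalg H).ι ⟶ (Functor.const (finiteCoalg H).FullSubcategory).obj (rhoCoalg H),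
      (∀ (A : (finiteCoalg H).FullSubcategory) (_ : Finite A.obj.V) (x : A.obj.V),
        (c.app A).f x = plus A.obj x) ∧
      Nonempty (IsColimit (Cocone.mk (rhoCoalg H) c)) ∧
      Nonempty (IsColimit ((Coalgebra.forget H).mapCocone (Cocone.mk (rhoCoalg H) c)))) ∧
    -- the structure is invertible, and its inverse makes `ϱH` the initial iterative algebra
    (∃ _ : IsIso (rhoCoalg H).str,
      IsIterative (rhoAlg H) ∧
      ∀ B : Endofunctor.Algebra H, IsIterative B →
        Nonempty (Unique (rhoAlg H ⟶ B))) :=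
  ⟨fun P _ => rhoCoalg_str_mk P,
    ⟨isLocallyFinite_rhoCoalg, fun _ hB => nonempty_unique_hom hB⟩,
    ⟨plusNatTrans H, fun _ _ _ => rfl, nonempty_isColimit, nonempty_isColimit_forget⟩,
    isIso_rhoCoalg_str hH,
    have := isIso_rhoCoalg_str hH
    ⟨isIterative_rhoAlg, fun _ hB => nonempty_unique_rhoAlg_hom hB⟩⟩
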